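/- Let $n \ge 4$. Call a set $S = \{p \in \mathbb{R}^2 : |p\cdot u| < h\}$ with $u \in \mathbb{R}^2$, $|u| = 1$, and $h > 0$ a symmetric strip, and call its central line $\{p : p \cdot u = 0\}$ the axis of $S$. Let $\mu_2$ be the measure on $\mathbb{R}^2$ given by $$d\mu_2 = C(n)\,|y|^{n-2} e^{-(x^2+y^2)/2}\,dx\,dy, \qquad C(n) = \Big(\int_{-\pi/2}^{\pi/2} \cos(t)^{n-2}\,dt\Big)^{-1}.$$ Suppose that for every two symmetric strips $S_1, S_2 \subset \mathbb{R}^2$ such that the axis of $S_1$ or the axis of $S_2$ is the $x$-axis, $$\mu_2(\mathbb{R}^2)\,\mu_2(S_1 \cap S_2) \ge \mu_2(S_1)\,\mu_2(S_2).$$ Then the Gaussian correlation inequality holds in $\mathbb{R}^n$: for every mean zero Gaussian measure $\mu$ on $\mathbb{R}^n$ (that is, every image of the standard Gaussian measure on $\mathbb{R}^n$ under a linear map $\mathbb{R}^n \to \mathbb{R}^n$) and all convex sets $K, M \subseteq \mathbb{R}^n$ that are symmetric about the origin, $$\mu(K \cap M) \ge \mu(K)\,\mu(M).$$ -/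

import Mathlib

open MeasureTheory ProbabilityTheory
open scoped RealInnerProductSpace

noncomputable section

/-- The constant `C(n) = (∫_{-π/2}^{π/2} cos(t)^(n-2) dt)⁻¹` (used for `n ≥ 4`). -/
def normConst (n : ℕ) : ℝ :=
  (∫ t in (-(Real.pi / 2))..(Real.pi / 2), Real.cos t ^ (n - 2))⁻¹

/-- The measure `μ₂ = C(n) |y|^(n-2) exp(-(x² + y²)/2) dx dy` on the plane; for a point `p` the
coordinate `p 0` is `x` and `p 1` is `y`. -/
def planeMeasure (n : ℕ) : Measure (EuclideanSpace ℝ (Fin 2)) :=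
  volume.withDensity fun p =>
    ENNReal.ofReal
      (normConst n * |p 1| ^ (n - 2) * Real.exp (-((p 0) ^ 2 + (p 1) ^ 2) / 2))

/-- The strip `{x : |x · u| < h}`. For a unit vector `u` and `h > 0` it is automatically open,
convex and symmetric about the origin. -/
def strip (u : EuclideanSpace ℝ (Fin 2)) (h : ℝ) : Set (EuclideanSpace ℝ (Fin 2)) :=
  {p | |⟪p, u⟫| < h}

/-- The axis of the strip `{x : |x · u| < h}`: its central line `{x : x · u = 0}`. -/
def stripAxis (u : EuclideanSpace ℝ (Fin 2)) : Set (EuclideanSpace ℝ (Fin 2)) :=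
  {p | ⟪p, u⟫ = 0}

/-- The `x`-axis of the plane. -/
def xAxis : Set (EuclideanSpace ℝ (Fin 2)) :=
  {p | p 1 = 0}

/-- The two-dimensional correlation condition with parameter `n`: the inequality
`μ₂(ℝ²) μ₂(S₁ ∩ S₂) ≥ μ₂(S₁) μ₂(S₂)` for all strips `S₁`, `S₂` one of which has the `x`-axis as
its axis. -/
def StripCorrelation (n : ℕ) : Prop :=
  ∀ (u₁ u₂ : EuclideanSpace ℝ (Fin 2)) (h₁ h₂ : ℝ),
    ‖u₁‖ = 1 → ‖u₂‖ = 1 → 0 < h₁ → 0 < h₂ →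
    (stripAxis u₁ = xAxis ∨ stripAxis u₂ = xAxis) →
    planeMeasure n Set.univ * planeMeasure n (strip u₁ h₁ ∩ strip u₂ h₂) ≥
      planeMeasure n (strip u₁ h₁) * planeMeasure n (strip u₂ h₂)

/-- A mean zero Gaussian measure on `ℝⁿ`: a linear image of the standard Gaussian measure
(degenerate images are allowed). -/
def IsMeanZeroGaussian {n : ℕ} (μ : Measure (EuclideanSpace ℝ (Fin n))) : Prop :=
  ∃ T : EuclideanSpace ℝ (Fin n) →ₗ[ℝ] EuclideanSpace ℝ (Fin n),
    μ = (stdGaussian (EuclideanSpace ℝ (Fin n))).map T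

end

/-! The Gaussian correlation inequality is obtained for all symmetric convex sets by Royen's
argument. A closed symmetric convex set is a countable intersection of strips, so it suffices to
compare, for a Gaussian vector X with covariance C split into two blocks, the probability that all
|X_i| ≤ c_i with the corresponding probability when the blocks are independent. Let C(τ) be C with
its cross-block entries multiplied by τ, so that C(1) = C and C(0) is the independent case.

The vector of the X_i²/2 has Laplace transform D(τ)^(-1/2), where D(τ) = det(1 + ΛC(τ)) and Λ =
diag(l). In D(τ) = Σ_s (∏_{i∈s} l_i) det C(τ)_s every principal minor is nonincreasing on [0,1]
(`Matrix.PosSemidef.antitoneOn_det_crossScale`). Hence D(1)^(-1/2) - D(0)^(-1/2) is a sum over s of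
∏_{i∈s} l_i times an integral of D(τ)^(-3/2) against a nonnegative weight, and D(τ)^(-3/2) is again
a Laplace transform, that of a sum of three independent copies.

Passing from laws to distribution functions, weighted by independent exponentials, replaces l by 1 +
l and divides by ∏(1 + l_i). This cancels the monomials ∏_{i∈s}(1 + l_i) and leaves inverse factors
that are Laplace transforms of exponential laws. So the difference of weighted distribution
functions is a positive measure (`cdf_le_of_isLaplaceTransform`). General Gaussian measures and sets
follow because frontiers of convex sets are null for the standard Gaussian. -/

/-! ### Monotonicity of determinants under scaling of the cross-block entries. -/

section Determinants

open Matrix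
open scoped MatrixOrder

variable {ι : Type*}

/-- The matrix `C` with the entries joining two different classes of `b` multiplied by `τ`. -/
def crossScale (C : Matrix ι ι ℝ) (b : ι → Bool) (τ : ℝ) : Matrix ι ι ℝ :=
  Matrix.of fun i j => if b i = b j then C i j else τ * C i j

theorem crossScale_one (C : Matrix ι ι ℝ) (b : ι → Bool) : crossScale C b 1 = C := by
  ext i j; simp [crossScale]

variable [Fintype ι] [DecidableEq ι]

theorem Matrix.IsHermitian.det_smul_one_add_smul {N : Matrix ι ι ℝ} (hN : N.IsHermitian)
    (a c : ℝ) : (a • (1 : Matrix ι ι ℝ) + c • N).det = ∏ i, (a + c * hN.eigenvalues i) := by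
  set U : Matrix ι ι ℝ := hN.eigenvectorUnitary.1
  have hUU : U * star U = 1 := Unitary.coe_mul_star_self hN.eigenvectorUnitary
  have hsp : N = U * diagonal hN.eigenvalues * star U := by
    conv_lhs => rw [hN.spectral_theorem, Unitary.conjStarAlgAut_apply]
    rfl
  have h : a • (1 : Matrix ι ι ℝ) + c • N
      = U * diagonal (fun i => a + c * hN.eigenvalues i) * star U := by
    have hd : diagonal (fun i => a + c * hN.eigenvalues i)
        = a • (1 : Matrix ι ι ℝ) + c • diagonal hN.eigenvalues := by
      ext i j
      by_cases hij : i = j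
      · subst hij; simp
      · simp [hij]
    rw [hd, Matrix.mul_add, Matrix.add_mul, Matrix.mul_smul, Matrix.mul_smul, Matrix.smul_mul,
      Matrix.smul_mul, ← hsp, Matrix.mul_one, hUU]
  rw [h, det_mul, det_mul, mul_right_comm, ← det_mul, hUU, det_one, one_mul, det_diagonal]

/-- A case of the log-concavity of the determinant. -/
theorem Matrix.PosDef.det_le_det_convex_combination {A B : Matrix ι ι ℝ} (hA : A.PosDef)
    (hB : B.PosSemidef) (hdet : B.det = A.det) {α : ℝ} (h0 : 0 ≤ α) (h1 : α ≤ 1) :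
    A.det ≤ (α • A + (1 - α) • B).det := by
  obtain ⟨R, hR⟩ := CStarAlgebra.nonneg_iff_eq_star_mul_self.mp hA.posSemidef.nonneg
  rw [star_eq_conjTranspose] at hR
  have hdA : 0 < A.det := hA.det_pos
  have hdR : R.det ≠ 0 := by
    intro h
    rw [hR, det_mul, h, mul_zero] at hdA
    exact hdA.false
  have hRu : IsUnit R.det := isUnit_iff_ne_zero.mpr hdR
  have hRu' : IsUnit Rᴴ.det := by rw [det_conjTranspose]; simpa using hdR
  -- Congruence by `R⁻¹` carries `A` to the identity and `B` to `N`. Equality of the two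
  -- determinants becomes `det N = 1`, and weighted AM-GM applied to each eigenvalue of `N`
  -- finishes.
  set N := (R⁻¹)ᴴ * B * R⁻¹ with hN
  have hNp : N.PosSemidef := hB.conjTranspose_mul_mul_same _
  have hBN : B = Rᴴ * N * R := by
    rw [hN, conjTranspose_nonsing_inv]
    calc B = (Rᴴ * (Rᴴ)⁻¹) * B * (R⁻¹ * R) := by
          rw [mul_nonsing_inv _ hRu', nonsing_inv_mul _ hRu, Matrix.one_mul, Matrix.mul_one]
      _ = _ := by simp only [Matrix.mul_assoc]
  have hAR : A.det = Rᴴ.det * R.det := by rw [hR, det_mul]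
  have hNd : N.det = 1 := by
    have : Rᴴ.det * N.det * R.det = Rᴴ.det * R.det := by
      rw [← hAR, ← hdet, ← det_mul, ← det_mul, ← hBN]
    have h2 : (Rᴴ.det * R.det) * N.det = (Rᴴ.det * R.det) * 1 := by
      linarith [mul_right_comm Rᴴ.det R.det N.det]
    exact mul_left_cancel₀ (by rw [← hAR]; exact hdA.ne') h2
  have hcomb : α • A + (1 - α) • B = Rᴴ * (α • (1 : Matrix ι ι ℝ) + (1 - α) • N) * R := by
    rw [Matrix.mul_add, Matrix.add_mul, Matrix.mul_smul, Matrix.mul_smul, Matrix.smul_mul,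
      Matrix.smul_mul, ← hBN, Matrix.mul_one, ← hR]
  have hge : 1 ≤ (α • (1 : Matrix ι ι ℝ) + (1 - α) • N).det := by
    rw [hNp.isHermitian.det_smul_one_add_smul]
    have hev : ∏ i, hNp.isHermitian.eigenvalues i = 1 := by
      have := hNp.isHermitian.det_eq_prod_eigenvalues
      rw [hNd] at this
      simpa using this.symm
    have hnn := hNp.eigenvalues_nonneg
    calc (1 : ℝ) = (∏ i, hNp.isHermitian.eigenvalues i) ^ (1 - α) := by rw [hev, Real.one_rpow]
      _ = ∏ i, (hNp.isHermitian.eigenvalues i) ^ (1 - α) :=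
        (Real.finsetProd_rpow _ _ (fun i _ => hnn i) _).symm
      _ ≤ ∏ i, (α + (1 - α) * hNp.isHermitian.eigenvalues i) := by
        refine Finset.prod_le_prod (fun i _ => Real.rpow_nonneg (hnn i) _) fun i _ => ?_
        have := Real.geom_mean_le_arith_mean2_weighted h0 (by linarith : 0 ≤ 1 - α) zero_le_one
          (hnn i) (by ring)
        simpa using this
  rw [hcomb, det_mul, det_mul, mul_right_comm, ← hAR]
  nlinarith

/-- The diagonal matrix of signs given by `b`. -/
def signMatrix (b : ι → Bool) : Matrix ι ι ℝ := diagonal fun i => if b i then 1 else -1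

/-- Conjugation by the signs keeps the diagonal blocks and negates the cross entries, so averaging
with weights `α` and `1 - α` multiplies the cross entries by `2α - 1`. -/
theorem crossScale_convex_combination (C : Matrix ι ι ℝ) (b : ι → Bool) (α σ : ℝ) :
    crossScale C b ((2 * α - 1) * σ) = α • crossScale C b σ
      + (1 - α) • ((signMatrix b)ᴴ * crossScale C b σ * signMatrix b) := by
  ext i j
  simp only [signMatrix, diagonal_conjTranspose, Matrix.add_apply, Matrix.smul_apply,
    mul_diagonal, diagonal_mul, crossScale, of_apply, smul_eq_mul]
  cases hi : b i <;> cases hj : b j <;> simp [hi] <;> ring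

theorem det_conj_signMatrix (b : ι → Bool) (A : Matrix ι ι ℝ) :
    ((signMatrix b)ᴴ * A * signMatrix b).det = A.det := by
  have h : (signMatrix b).det * (signMatrix b).det = 1 := by
    rw [← det_mul, signMatrix, diagonal_mul_diagonal, det_diagonal]
    refine Finset.prod_eq_one fun i _ => ?_
    split_ifs <;> norm_num
  rw [det_mul, det_mul, det_conjTranspose]
  simp only [star_trivial]
  rw [mul_right_comm, h, one_mul]

theorem Matrix.PosSemidef.crossScale {C : Matrix ι ι ℝ} (hC : C.PosSemidef) (b : ι → Bool)
    {τ : ℝ} (h0 : 0 ≤ τ) (h1 : τ ≤ 1) : (crossScale C b τ).PosSemidef := by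
  have h := crossScale_convex_combination C b ((1 + τ) / 2) 1
  rw [crossScale_one, show (2 * ((1 + τ) / 2) - 1) * 1 = τ by ring] at h
  rw [h]
  exact (hC.smul (by linarith)).add ((hC.conjTranspose_mul_mul_same _).smul (by linarith))

/-- For `τ ≤ σ` the matrix at `τ` is a convex combination, with `α = (1 + τ/σ)/2`, of the matrix at
`σ` and its sign conjugate. These have equal determinants, so log-concavity applies. If the
determinant at `σ` vanishes, nonnegativity at `τ` suffices. -/
theorem Matrix.PosSemidef.antitoneOn_det_crossScale {C : Matrix ι ι ℝ} (hC : C.PosSemidef)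
    (b : ι → Bool) : AntitoneOn (fun τ => (_root_.crossScale C b τ).det) (Set.Icc 0 1) := by
  intro τ hτ σ hσ hle
  rcases eq_or_ne (_root_.crossScale C b σ).det 0 with h | h
  · simp only [h]
    exact (hC.crossScale b hτ.1 hτ.2).det_nonneg
  rcases hσ.1.eq_or_lt with h0 | h0
  · have : τ = σ := le_antisymm hle (h0 ▸ hτ.1)
    rw [this]
  have hps := hC.crossScale b hσ.1 hσ.2
  have hpd := hps.posDef_iff_det_ne_zero.mpr h
  have hle' : τ / σ ≤ 1 := (div_le_one h0).mpr hle
  have hnn : 0 ≤ τ / σ := div_nonneg hτ.1 h0.le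
  have key := hpd.det_le_det_convex_combination (hps.conjTranspose_mul_mul_same (signMatrix b))
    (det_conj_signMatrix b _) (α := (1 + τ / σ) / 2) (by linarith) (by linarith)
  rw [← crossScale_convex_combination] at key
  have h2 : (2 * ((1 + τ / σ) / 2) - 1) * σ = τ := by field_simp; ring
  rwa [h2] at key

/-- The expansion of `det (1 + ΛM)` in principal minors of `M`. -/
theorem det_one_add_diagonal_mul (l : ι → ℝ) (M : Matrix ι ι ℝ) :
    (1 + diagonal l * M).det = ∑ s : Finset ι,
      (∏ i ∈ s, l i) * (M.submatrix (Subtype.val : s → ι) Subtype.val).det := by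
  -- Row `i` of the matrix is `l i • M i` plus a row of the identity; multilinearity in the rows
  -- produces one term per set `s` of rows taken from `M`.
  have h := (detRowAlternating (n := ι) (R := ℝ)).toMultilinearMap.map_add_univ
    (fun i => l i • M i) (fun i => (1 : Matrix ι ι ℝ) i)
  have e1 : (1 + diagonal l * M).det = (detRowAlternating (n := ι) (R := ℝ)).toMultilinearMap
      ((fun i => l i • M i) + fun i => (1 : Matrix ι ι ℝ) i) := by
    change _ = Matrix.det _
    congr 1
    ext i j
    simp [diagonal_mul, add_comm]
  rw [e1, h]
  refine Finset.sum_congr rfl fun s _ => ?_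
  rw [← det_piecewise_one_eq_submatrix_det]
  have e2 : (s.piecewise (fun i => l i • M i) fun i => (1 : Matrix ι ι ℝ) i)
      = fun i => (if i ∈ s then l i else 1) • (s.piecewise M.row (1 : Matrix ι ι ℝ).row) i := by
    funext i
    by_cases hi : i ∈ s <;> simp [hi] <;> rfl
  rw [e2, MultilinearMap.map_smul_univ]
  congr 1
  simp [Finset.prod_ite_mem]

theorem contDiff_det_crossScale (C : Matrix ι ι ℝ) (b : ι → Bool) :
    ContDiff ℝ 1 fun τ => (crossScale C b τ).det := by
  simp only [det_apply, crossScale, of_apply]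
  refine ContDiff.sum fun σ _ => ContDiff.const_smul _ (contDiff_prod fun i _ => ?_)
  split_ifs <;> fun_prop

theorem deriv_nonpos_of_antitoneOn_Icc {f : ℝ → ℝ} (hf : ContDiff ℝ 1 f)
    (ha : AntitoneOn f (Set.Icc 0 1)) {t : ℝ} (ht : t ∈ Set.Icc (0 : ℝ) 1) : deriv f t ≤ 0 := by
  have hmem : ∀ t ∈ Set.Ioo (0 : ℝ) 1, deriv f t ≤ 0 := fun t ht => by
    have := ha.derivWithin_nonpos (x := t)
    rwa [derivWithin_of_mem_nhds (Icc_mem_nhds ht.1 ht.2)] at this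
  have hcl : IsClosed {t | deriv f t ≤ 0} :=
    isClosed_le (hf.continuous_deriv le_rfl) continuous_const
  have := hcl.closure_subset_iff.mpr (fun t ht => hmem t ht)
  rw [closure_Ioo zero_ne_one] at this
  exact this ht

end Determinants

/-! ### Laplace transforms on the orthant and comparison of distribution functions. -/

section LaplaceTransform

open scoped NNReal ENNReal BoundedContinuousFunction

variable {ι : Type*} [Fintype ι]

/-- The exponential function `x ↦ exp (-⟨l, x⟩)` on the nonnegative orthant. -/
noncomputable def expNeg (l x : ι → ℝ≥0) : ℝ := Real.exp (-∑ i, (l i : ℝ) * x i)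

theorem expNeg_add_left (l m x : ι → ℝ≥0) : expNeg (l + m) x = expNeg l x * expNeg m x := by
  simp only [expNeg, ← Real.exp_add, Pi.add_apply, NNReal.coe_add, add_mul, Finset.sum_add_distrib,
    neg_add]

theorem expNeg_add_right (l x y : ι → ℝ≥0) : expNeg l (x + y) = expNeg l x * expNeg l y := by
  simp only [expNeg, ← Real.exp_add, Pi.add_apply, NNReal.coe_add, mul_add, Finset.sum_add_distrib,
    neg_add]

theorem expNeg_nonneg (l x : ι → ℝ≥0) : 0 ≤ expNeg l x := (Real.exp_pos _).le

theorem expNeg_le_one (l x : ι → ℝ≥0) : expNeg l x ≤ 1 := by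
  refine Real.exp_le_one_iff.mpr (neg_nonpos.mpr ?_)
  positivity

theorem expNeg_eq_prod (l x : ι → ℝ≥0) : expNeg l x = ∏ i, Real.exp (-(l i * x i)) := by
  rw [expNeg, ← Real.exp_sum, Finset.sum_neg_distrib]

theorem continuous_expNeg (l : ι → ℝ≥0) : Continuous (expNeg l) := by
  unfold expNeg; fun_prop

theorem measurable_expNeg (l : ι → ℝ≥0) : Measurable (expNeg l) := (continuous_expNeg l).measurable

theorem integrable_expNeg_comp {Ω : Type*} [MeasurableSpace Ω] (m : Measure Ω) [IsFiniteMeasure m]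
    {W : Ω → ι → ℝ≥0} (hW : Measurable W) (l : ι → ℝ≥0) :
    Integrable (fun ω => expNeg l (W ω)) m := by
  refine Integrable.of_bound ((measurable_expNeg l).comp hW).aestronglyMeasurable 1 ?_
  refine Filter.Eventually.of_forall fun ω => ?_
  rw [Real.norm_of_nonneg (expNeg_nonneg _ _)]
  exact expNeg_le_one _ _

theorem integrable_expNeg (m : Measure (ι → ℝ≥0)) [IsFiniteMeasure m] (l : ι → ℝ≥0) :
    Integrable (expNeg l) m := integrable_expNeg_comp m measurable_id l

/-- `expNeg l` as a bounded continuous function. -/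
noncomputable def expNegBCF (l : ι → ℝ≥0) : (ι → ℝ≥0) →ᵇ ℝ :=
  BoundedContinuousFunction.ofNormedAddCommGroup (expNeg l) (continuous_expNeg l) 1 fun x => by
    rw [Real.norm_of_nonneg (expNeg_nonneg _ _)]
    exact expNeg_le_one _ _

@[simp] theorem expNegBCF_apply (l x : ι → ℝ≥0) : expNegBCF l x = expNeg l x := rfl

/-- The functions `expNeg l` form a multiplicative monoid. -/
noncomputable def expNegMonoid (ι : Type*) [Fintype ι] : Submonoid ((ι → ℝ≥0) →ᵇ ℝ) where
  carrier := Set.range expNegBCF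
  one_mem' := ⟨0, by ext x; simp [expNeg]⟩
  mul_mem' := by
    rintro _ _ ⟨l, rfl⟩ ⟨m, rfl⟩
    exact ⟨l + m, by ext x; simp [expNeg_add_left]⟩

/-- The star algebra generated by the functions `expNeg l`. -/
noncomputable def expNegAlgebra (ι : Type*) [Fintype ι] : StarSubalgebra ℝ ((ι → ℝ≥0) →ᵇ ℝ) where
  __ := Algebra.adjoin ℝ (expNegMonoid ι : Set ((ι → ℝ≥0) →ᵇ ℝ))
  star_mem' := fun {a} ha => by
    have : star a = a := by ext x; simp
    rwa [this]

/-- A finite measure on the nonnegative orthant is determined by its Laplace transform. -/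
theorem ext_of_integral_expNeg_eq {μ ν : Measure (ι → ℝ≥0)} [IsFiniteMeasure μ]
    [IsFiniteMeasure ν] (h : ∀ l, ∫ x, expNeg l x ∂μ = ∫ x, expNeg l x ∂ν) : μ = ν := by
  classical
  refine ext_of_forall_mem_subalgebra_integral_eq_of_polish (𝕜 := ℝ) (A := expNegAlgebra ι) ?_ ?_
  · intro x y hxy
    obtain ⟨i, hi⟩ := Function.ne_iff.mp hxy
    refine ⟨expNeg (Pi.single i 1), ⟨⟨expNeg (Pi.single i 1), continuous_expNeg _⟩,
      ⟨expNegBCF (Pi.single i 1), Algebra.subset_adjoin ⟨_, rfl⟩, rfl⟩, rfl⟩, ?_⟩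
    have hs : ∀ z : ι → ℝ≥0, expNeg (Pi.single i 1) z = Real.exp (-(z i)) := fun z => by
      rw [expNeg, Finset.sum_eq_single i] <;> simp +contextual
    rw [hs, hs]
    simpa using hi
  · intro g hg
    -- The generators are closed under multiplication, so the algebra is just their linear span and
    -- the integrals agree by linearity.
    have hg' : g ∈ Submodule.span ℝ (expNegMonoid ι : Set ((ι → ℝ≥0) →ᵇ ℝ)) := by
      have h2 : g ∈ Subalgebra.toSubmodule (Algebra.adjoin ℝ
        (expNegMonoid ι : Set ((ι → ℝ≥0) →ᵇ ℝ))) := hg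
      rwa [Algebra.adjoin_eq_span, Submonoid.closure_eq] at h2
    refine Submodule.span_induction (p := fun g _ => ∫ x, g x ∂μ = ∫ x, g x ∂ν)
      ?_ (by simp) ?_ ?_ hg'
    · rintro _ ⟨l, rfl⟩
      exact h l
    · intro f g _ _ hf hg
      have := integral_add (f.integrable μ) (g.integrable μ)
      have h2 := integral_add (f.integrable ν) (g.integrable ν)
      simp only [BoundedContinuousFunction.coe_add, Pi.add_apply]
      rw [this, h2, hf, hg]
    · intro a f _ hf
      simp only [BoundedContinuousFunction.coe_smul, integral_smul, hf]

/-- `g` is the Laplace transform of a finite measure on the nonnegative orthant. -/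
def IsLaplaceTransform (g : (ι → ℝ≥0) → ℝ) : Prop :=
  ∃ ν : Measure (ι → ℝ≥0), IsFiniteMeasure ν ∧ ∀ l, g l = ∫ x, expNeg l x ∂ν

namespace IsLaplaceTransform

theorem of_integral {Ω : Type*} [MeasurableSpace Ω] (m : Measure Ω) [IsFiniteMeasure m]
    {W : Ω → ι → ℝ≥0} (hW : Measurable W) :
    IsLaplaceTransform fun l => ∫ ω, expNeg l (W ω) ∂m :=
  ⟨m.map W, inferInstance, fun l =>
    (integral_map hW.aemeasurable (measurable_expNeg l).aestronglyMeasurable).symm⟩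

theorem one : IsLaplaceTransform fun _ : ι → ℝ≥0 => (1 : ℝ) :=
  ⟨Measure.dirac 0, inferInstance, fun l => by simp [expNeg]⟩

theorem add {g h : (ι → ℝ≥0) → ℝ} (hg : IsLaplaceTransform g) (hh : IsLaplaceTransform h) :
    IsLaplaceTransform fun l => g l + h l := by
  obtain ⟨μ, hμ, hg⟩ := hg
  obtain ⟨ν, hν, hh⟩ := hh
  refine ⟨μ + ν, inferInstance, fun l => ?_⟩
  rw [integral_add_measure (integrable_expNeg μ l)
    (integrable_expNeg ν l), ← hg, ← hh]

theorem mul {g h : (ι → ℝ≥0) → ℝ} (hg : IsLaplaceTransform g) (hh : IsLaplaceTransform h) :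
    IsLaplaceTransform fun l => g l * h l := by
  obtain ⟨μ, hμ, hg⟩ := hg
  obtain ⟨ν, hν, hh⟩ := hh
  have := of_integral (μ.prod ν) (W := fun p : (ι → ℝ≥0) × (ι → ℝ≥0) => p.1 + p.2)
    (by fun_prop)
  convert this using 2 with l
  simp only [expNeg_add_right]
  rw [integral_prod_mul (expNeg l) (expNeg l), hg, hh]

theorem sum {α : Type*} (s : Finset α) {g : α → (ι → ℝ≥0) → ℝ}
    (hg : ∀ a ∈ s, IsLaplaceTransform (g a)) : IsLaplaceTransform fun l => ∑ a ∈ s, g a l := by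
  classical
  induction s using Finset.induction_on with
  | empty => exact ⟨0, inferInstance, fun l => by simp⟩
  | insert a s ha ih =>
    simp only [Finset.sum_insert ha]
    exact (hg a (Finset.mem_insert_self a s)).add
      (ih fun b hb => hg b (Finset.mem_insert_of_mem hb))

theorem prod {α : Type*} (s : Finset α) {g : α → (ι → ℝ≥0) → ℝ}
    (hg : ∀ a ∈ s, IsLaplaceTransform (g a)) : IsLaplaceTransform fun l => ∏ a ∈ s, g a l := by
  classical
  induction s using Finset.induction_on with
  | empty => simpa using one
  | insert a s ha ih =>
    simp only [Finset.prod_insert ha]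
    exact (hg a (Finset.mem_insert_self a s)).mul
      (ih fun b hb => hg b (Finset.mem_insert_of_mem hb))

/-- Multiplying the measure by `expNeg m` translates the Laplace transform by `m`. -/
theorem comp_add {g : (ι → ℝ≥0) → ℝ} (hg : IsLaplaceTransform g) (m : ι → ℝ≥0) :
    IsLaplaceTransform fun l => g (m + l) := by
  obtain ⟨μ, hμ, hg⟩ := hg
  refine ⟨μ.withDensity fun x => ENNReal.ofReal (expNeg m x), ?_, fun l => ?_⟩
  · exact isFiniteMeasure_withDensity_ofReal (integrable_expNeg_comp μ measurable_id m).2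
  · rw [integral_withDensity_eq_integral_toReal_smul
      (measurable_expNeg m).ennreal_ofReal (by simp)]
    simp only [hg]
    refine integral_congr_ae (Filter.Eventually.of_forall fun x => ?_)
    simp [expNeg_add_left, ENNReal.toReal_ofReal (expNeg_nonneg m x)]

end IsLaplaceTransform

/-- The standard exponential distribution on `[0, ∞)`. -/
noncomputable def stdExp : Measure ℝ≥0 :=
  ((volume.restrict (Set.Ioi (0 : ℝ))).withDensity fun t => ENNReal.ofReal (Real.exp (-t))).map
    Real.toNNReal

theorem integrableOn_exp_neg_mul_Ioi {a : ℝ} (ha : 0 < a) (z : ℝ) :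
    IntegrableOn (fun t => Real.exp (-(a * t))) (Set.Ioi z) := by
  simpa [neg_mul] using integrableOn_exp_mul_Ioi (neg_neg_of_pos ha) z

instance : IsFiniteMeasure stdExp := by
  have : IsFiniteMeasure ((volume.restrict (Set.Ioi (0 : ℝ))).withDensity
      fun t => ENNReal.ofReal (Real.exp (-t))) :=
    isFiniteMeasure_withDensity_ofReal (by simpa using (integrableOn_exp_neg_mul_Ioi one_pos 0).2)
  unfold stdExp
  infer_instance

theorem integral_stdExp_indicator (l z : ℝ≥0) :
    ∫ s, (Set.Ici z).indicator (fun s : ℝ≥0 => Real.exp (-(l * s))) s ∂stdExp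
      = Real.exp (-((1 + l) * z)) / (1 + l) := by
  have hm : Measurable ((Set.Ici z).indicator fun s : ℝ≥0 => Real.exp (-((l : ℝ) * s))) :=
    Measurable.indicator (by fun_prop) measurableSet_Ici
  have hl : (0 : ℝ) < 1 + l := by positivity
  rw [stdExp, integral_map (by fun_prop) hm.aestronglyMeasurable,
    integral_withDensity_eq_integral_toReal_smul (by fun_prop) (by simp)]
  have h1 : ∀ t ∈ Set.Ioi (0 : ℝ), (ENNReal.ofReal (Real.exp (-t))).toReal •
      (Set.Ici z).indicator (fun s : ℝ≥0 => Real.exp (-((l : ℝ) * s))) t.toNNReal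
      = (Set.Ici (z : ℝ)).indicator (fun t => Real.exp (-((1 + l) * t))) t := by
    intro t ht
    have ht' : (0 : ℝ) ≤ t := le_of_lt ht
    rw [ENNReal.toReal_ofReal (Real.exp_pos _).le]
    by_cases hz : (z : ℝ) ≤ t
    · rw [Set.indicator_of_mem (by simpa using NNReal.le_toNNReal_of_coe_le hz),
        Set.indicator_of_mem (by simpa using hz), smul_eq_mul, ← Real.exp_add,
        Real.coe_toNNReal t ht']
      congr 1; ring
    · rw [Set.indicator_of_notMem (by simpa [Real.le_toNNReal_iff_coe_le ht'] using hz),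
        Set.indicator_of_notMem (by simpa using hz), smul_zero]
  rw [setIntegral_congr_fun measurableSet_Ioi h1, setIntegral_indicator measurableSet_Ici]
  have h2 : (Set.Ioi (0 : ℝ) ∩ Set.Ici (z : ℝ) : Set ℝ) =ᵐ[volume] Set.Ioi (z : ℝ) := by
    have h3 : Set.Ioi (z : ℝ) = (Set.Ioi 0 ∩ Set.Ioi (z : ℝ) : Set ℝ) := by
      rw [Set.Ioi_inter_Ioi, sup_of_le_right z.coe_nonneg]
    rw [h3]
    exact (Filter.EventuallyEq.refl _ _).inter Ioi_ae_eq_Ici.symm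
  rw [setIntegral_congr_set h2]
  have h4 := integral_exp_mul_Ioi (neg_neg_of_pos hl) z
  simp only [neg_mul] at h4
  rw [h4, neg_div_neg_eq]

theorem stdExp_real_Ici (z : ℝ≥0) : stdExp.real (Set.Ici z) = Real.exp (-z) := by
  have := integral_stdExp_indicator 0 z
  rw [integral_indicator measurableSet_Ici] at this
  simpa using this

theorem stdExp_Ico_pos (z : ℝ≥0) {ε : ℝ≥0} (hε : 0 < ε) : 0 < stdExp (Set.Ico z (z + ε)) := by
  refine pos_iff_ne_zero.mpr fun h => ?_
  have h1 : stdExp.real (Set.Ici z) ≤ stdExp.real (Set.Ico z (z + ε))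
      + stdExp.real (Set.Ici (z + ε)) := by
    refine (measureReal_mono ?_).trans (measureReal_union_le _ _)
    rw [Set.Ico_union_Ici_eq_Ici (by simp)]
  rw [stdExp_real_Ici, stdExp_real_Ici, measureReal_def, h, ENNReal.toReal_zero, zero_add,
    Real.exp_le_exp] at h1
  have : (0 : ℝ) < ε := hε
  push_cast at h1
  linarith

theorem IsLaplaceTransform.inv_one_add (i : ι) :
    IsLaplaceTransform fun l : ι → ℝ≥0 => (1 + (l i : ℝ))⁻¹ := by
  classical
  have h := IsLaplaceTransform.of_integral stdExp
    (W := fun t => (Pi.single i t : ι → ℝ≥0)) (continuous_single i).measurable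
  convert h using 2 with l
  have h1 := integral_stdExp_indicator (l i) 0
  simp only [NNReal.coe_zero, mul_zero, neg_zero, Real.exp_zero, one_div] at h1
  rw [← h1]
  refine integral_congr_ae (Filter.Eventually.of_forall fun t => ?_)
  simp only
  rw [Set.indicator_of_mem (by simp), expNeg, Finset.sum_eq_single i] <;>
    simp +contextual

/-- The measure with density `s ↦ P (Z ≤ s)` with respect to independent standard exponential
variables. -/
noncomputable def cdfMeasure {Ω : Type*} [MeasurableSpace Ω] (P : Measure Ω) (Z : Ω → ι → ℝ≥0) :
    Measure (ι → ℝ≥0) :=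
  (Measure.pi fun _ => stdExp).withDensity fun s => P {ω | Z ω ≤ s}

section CdfMeasure

variable {Ω : Type*} [MeasurableSpace Ω] (P : Measure Ω) [IsProbabilityMeasure P]
  {Z : Ω → ι → ℝ≥0}

theorem measurableSet_graph_le (hZ : Measurable Z) :
    MeasurableSet {p : (ι → ℝ≥0) × Ω | Z p.2 ≤ p.1} := by
  simp only [Pi.le_def, Set.ofPred_forall]
  exact MeasurableSet.iInter fun i => measurableSet_le (by fun_prop) (by fun_prop)

theorem measurable_cdf (hZ : Measurable Z) : Measurable fun s : ι → ℝ≥0 => P {ω | Z ω ≤ s} :=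
  measurable_measure_prodMk_left (measurableSet_graph_le hZ)

instance isFiniteMeasure_cdfMeasure : IsFiniteMeasure (cdfMeasure P Z) := by
  refine isFiniteMeasure_withDensity (ne_top_of_le_ne_top (measure_ne_top
    (Measure.pi fun _ : ι => stdExp) Set.univ) ?_)
  calc ∫⁻ s, P {ω | Z ω ≤ s} ∂Measure.pi (fun _ : ι => stdExp)
      ≤ ∫⁻ _, 1 ∂Measure.pi (fun _ : ι => stdExp) := lintegral_mono fun s => prob_le_one
    _ = _ := by simp

/-- By Fubini, the integral over `s ≥ Z ω` factors into the one-dimensional integrals of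
`integral_stdExp_indicator`. The exponential reference measure keeps `cdfMeasure` finite and is the
source of the shift from `l` to `1 + l`. -/
theorem integral_expNeg_cdfMeasure (hZ : Measurable Z) (l : ι → ℝ≥0) :
    ∫ s, expNeg l s ∂cdfMeasure P Z
      = (∏ i, (1 + (l i : ℝ))⁻¹) * ∫ ω, expNeg (1 + l) (Z ω) ∂P := by
  set β : Measure (ι → ℝ≥0) := Measure.pi fun _ => stdExp
  have hG := measurableSet_graph_le hZ
  have e1 : ∫ s, expNeg l s ∂cdfMeasure P Z
      = ∫ s, ∫ ω, {p : (ι → ℝ≥0) × Ω | Z p.2 ≤ p.1}.indicator (fun p => expNeg l p.1) (s, ω) ∂P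
        ∂β := by
    rw [cdfMeasure, integral_withDensity_eq_integral_toReal_smul (measurable_cdf P hZ) (by simp)]
    refine integral_congr_ae (Filter.Eventually.of_forall fun s => ?_)
    have : (fun ω => {p : (ι → ℝ≥0) × Ω | Z p.2 ≤ p.1}.indicator (fun p => expNeg l p.1) (s, ω))
        = {ω | Z ω ≤ s}.indicator fun _ => expNeg l s := by
      rfl
    have hms : MeasurableSet {ω | Z ω ≤ s} := measurable_prodMk_left (x := s) hG
    beta_reduce
    rw [this, integral_indicator_const _ hms]
    rfl
  have hint : Integrable ({p : (ι → ℝ≥0) × Ω | Z p.2 ≤ p.1}.indicator fun p => expNeg l p.1)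
      (β.prod P) :=
    (integrable_expNeg_comp (β.prod P) measurable_fst l).indicator hG
  rw [e1, integral_integral_swap (f := fun s ω =>
    {p : (ι → ℝ≥0) × Ω | Z p.2 ≤ p.1}.indicator (fun p => expNeg l p.1) (s, ω)) hint, ← integral_const_mul]
  refine integral_congr_ae (Filter.Eventually.of_forall fun ω => ?_)
  have e2 : (fun s => {p : (ι → ℝ≥0) × Ω | Z p.2 ≤ p.1}.indicator (fun p => expNeg l p.1) (s, ω))
      = fun s : ι → ℝ≥0 => ∏ i, (Set.Ici (Z ω i)).indicator
        (fun t : ℝ≥0 => Real.exp (-(l i * t))) (s i) := by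
    ext s
    by_cases h : Z ω ≤ s
    · rw [Set.indicator_of_mem (by exact h), expNeg_eq_prod]
      exact Finset.prod_congr rfl fun i _ => by rw [Set.indicator_of_mem (by exact h i)]
    · rw [Set.indicator_of_notMem (by exact h)]
      obtain ⟨i, hi⟩ := not_forall.mp h
      exact (Finset.prod_eq_zero (Finset.mem_univ i)
        (Set.indicator_of_notMem (by exact hi) _)).symm
  simp only
  rw [e2, integral_fintype_prod_eq_prod (f := fun i => (Set.Ici (Z ω i)).indicator
        (fun t : ℝ≥0 => Real.exp (-(l i * t)))), expNeg_eq_prod, ← Finset.prod_mul_distrib]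
  refine Finset.prod_congr rfl fun i _ => ?_
  rw [integral_stdExp_indicator]
  simp [div_eq_inv_mul]

end CdfMeasure

/-- Comparison of distribution functions by means of Laplace transforms. -/
theorem cdf_le_of_isLaplaceTransform {Ω₀ Ω₁ : Type*} [MeasurableSpace Ω₀] [MeasurableSpace Ω₁]
    (P₀ : Measure Ω₀) (P₁ : Measure Ω₁) [IsProbabilityMeasure P₀] [IsProbabilityMeasure P₁]
    {Z₀ : Ω₀ → ι → ℝ≥0} {Z₁ : Ω₁ → ι → ℝ≥0} (hZ₀ : Measurable Z₀) (hZ₁ : Measurable Z₁)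
    (h : IsLaplaceTransform fun l : ι → ℝ≥0 => (∏ i, (1 + (l i : ℝ))⁻¹) *
      (∫ ω, expNeg (1 + l) (Z₁ ω) ∂P₁ - ∫ ω, expNeg (1 + l) (Z₀ ω) ∂P₀)) (s : ι → ℝ≥0) :
    P₀ {ω | Z₀ ω ≤ s} ≤ P₁ {ω | Z₁ ω ≤ s} := by
  obtain ⟨ν, hν, hl⟩ := h
  have heq : cdfMeasure P₀ Z₀ + ν = cdfMeasure P₁ Z₁ := by
    refine ext_of_integral_expNeg_eq fun l => ?_
    rw [integral_add_measure (integrable_expNeg _ l)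
      (integrable_expNeg _ l), ← hl, integral_expNeg_cdfMeasure P₀ hZ₀,
      integral_expNeg_cdfMeasure P₁ hZ₁]
    ring
  have hle : cdfMeasure P₀ Z₀ ≤ cdfMeasure P₁ Z₁ := heq ▸ Measure.le_add_right le_rfl
  set β : Measure (ι → ℝ≥0) := Measure.pi fun _ => stdExp with hβ
  -- Inequality of measures compares the densities only almost everywhere. Monotonicity of the
  -- distribution functions on a small box above `s`, of positive measure, recovers the value at `s`
  -- up to `ε`; right continuity then removes `ε`.
  have step : ∀ ε : ℝ≥0, 0 < ε → P₀ {ω | Z₀ ω ≤ s} ≤ P₁ {ω | Z₁ ω ≤ fun i => s i + ε} := by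
    intro ε hε
    set B : Set (ι → ℝ≥0) := Set.univ.pi fun i => Set.Ico (s i) (s i + ε) with hB
    have hBm : MeasurableSet B := MeasurableSet.univ_pi fun i => measurableSet_Ico
    have hB0 : β B ≠ 0 := by
      rw [hβ, hB, Measure.pi_pi]
      exact Finset.prod_ne_zero_iff.mpr fun i _ => (stdExp_Ico_pos _ hε).ne'
    have h0 : P₀ {ω | Z₀ ω ≤ s} * β B ≤ cdfMeasure P₀ Z₀ B := by
      rw [cdfMeasure, withDensity_apply _ hBm, ← setLIntegral_const]
      refine setLIntegral_mono' hBm fun x hx => measure_mono fun ω hω => ?_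
      exact fun i => (hω i).trans (hx i trivial).1
    have h1 : cdfMeasure P₁ Z₁ B ≤ P₁ {ω | Z₁ ω ≤ fun i => s i + ε} * β B := by
      rw [cdfMeasure, withDensity_apply _ hBm, ← setLIntegral_const]
      refine setLIntegral_mono' hBm fun x hx => measure_mono fun ω hω => ?_
      exact fun i => (hω i).trans (hx i trivial).2.le
    exact (ENNReal.mul_le_mul_iff_left hB0 (measure_ne_top β B)).mp (h0.trans ((hle B).trans h1))
  have hinter : {ω | Z₁ ω ≤ s} = ⋂ n : ℕ, {ω | Z₁ ω ≤ fun i => s i + 1 / ((n : ℝ≥0) + 1)} := by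
    ext ω
    simp only [Set.mem_ofPred_eq, Set.mem_iInter, Pi.le_def]
    refine ⟨fun h n i => (h i).trans (by simp), fun h i => ?_⟩
    have ht : Filter.Tendsto (fun n : ℕ => s i + 1 / ((n : ℝ≥0) + 1)) Filter.atTop
        (nhds (s i + 0)) := tendsto_const_nhds.add tendsto_one_div_add_atTop_nhds_zero_nat
    rw [add_zero] at ht
    exact ge_of_tendsto' ht fun n => h n i
  have hms : ∀ u : ι → ℝ≥0, MeasurableSet {ω | Z₁ ω ≤ u} := fun u =>
    measurable_prodMk_left (x := u) (measurableSet_graph_le hZ₁)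
  have hanti : Antitone fun n : ℕ => {ω | Z₁ ω ≤ fun i => s i + 1 / ((n : ℝ≥0) + 1)} := by
    intro m n hmn ω hω i
    refine (hω i).trans (add_le_add le_rfl ?_)
    exact one_div_le_one_div_of_le (by positivity) (by gcongr)
  rw [hinter, hanti.measure_iInter (fun n => (hms _).nullMeasurableSet) ⟨0, measure_ne_top _ _⟩]
  exact le_iInf fun n => step _ (by positivity)

end LaplaceTransform

/-! ### Laplace transforms of squared Gaussian vectors. -/

section GaussianSquares

open Matrix
open scoped NNReal ENNReal

variable {ι κ : Type*} [Fintype ι] [Fintype κ]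

/-- The law of independent standard Gaussian variables. -/
noncomputable def piGaussian (κ : Type*) [Fintype κ] : Measure (κ → ℝ) :=
  Measure.pi fun _ => gaussianReal 0 1

instance : IsProbabilityMeasure (piGaussian κ) := by unfold piGaussian; infer_instance

theorem integral_exp_neg_mul_sq_gaussianReal {q : ℝ} (hq : 0 ≤ q) :
    ∫ x, Real.exp (-(q * x ^ 2 / 2)) ∂gaussianReal 0 1 = (1 + q) ^ (-(1 / 2) : ℝ) := by
  have hq' : 0 < 1 + q := by linarith
  rw [integral_gaussianReal_eq_integral_smul one_ne_zero]
  have h : ∀ x : ℝ, gaussianPDFReal 0 1 x • Real.exp (-(q * x ^ 2 / 2))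
      = (√(2 * Real.pi))⁻¹ * Real.exp (-((1 + q) / 2) * x ^ 2) := by
    intro x
    simp only [gaussianPDFReal, NNReal.coe_one, mul_one, sub_zero, smul_eq_mul]
    rw [mul_assoc, ← Real.exp_add]
    congr 2; ring
  simp_rw [h]
  rw [integral_const_mul, integral_gaussian, ← Real.sqrt_inv, ← Real.sqrt_mul (by positivity),
    Real.rpow_neg hq'.le, ← Real.sqrt_eq_rpow, ← Real.sqrt_inv]
  congr 1
  field_simp

theorem piGaussian_map_mulVec [DecidableEq κ] {N : Matrix κ κ ℝ} (hN : N.IsHermitian) :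
    (piGaussian κ).map (fun x => hN.eigenvectorUnitary.1 *ᵥ x) = piGaussian κ := by
  have h := stdGaussian_eq_map_pi_orthonormalBasis hN.eigenvectorBasis
  rw [← map_pi_eq_stdGaussian] at h
  have h2 := congrArg (fun m => m.map (WithLp.ofLp : EuclideanSpace ℝ κ → κ → ℝ)) h
  simp only at h2
  rw [Measure.map_map (by fun_prop) (by fun_prop), Measure.map_map (by fun_prop) (by fun_prop)]
    at h2
  have e1 : (WithLp.ofLp : EuclideanSpace ℝ κ → κ → ℝ) ∘ WithLp.toLp 2 = id := rfl
  rw [e1, Measure.map_id] at h2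
  unfold piGaussian
  conv_rhs => rw [h2]
  congr 1
  funext x i
  simp [mulVec, dotProduct, WithLp.ofLp_sum, Finset.sum_apply, mul_comm]

/-- Rotation invariance diagonalises `N`, and the integral splits into one-dimensional Gaussian
integrals, one per eigenvalue. -/
theorem integral_exp_neg_quadratic_piGaussian [DecidableEq κ] {N : Matrix κ κ ℝ}
    (hN : N.PosSemidef) :
    ∫ x, Real.exp (-(x ⬝ᵥ N *ᵥ x / 2)) ∂piGaussian κ = (1 + N).det ^ (-(1 / 2) : ℝ) := by
  set U : Matrix κ κ ℝ := hN.isHermitian.eigenvectorUnitary.1 with hU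
  have hUU : star U * U = 1 := Unitary.coe_star_mul_self hN.isHermitian.eigenvectorUnitary
  have hsp : N = U * diagonal hN.isHermitian.eigenvalues * star U := by
    conv_lhs => rw [hN.isHermitian.spectral_theorem, Unitary.conjStarAlgAut_apply]
    rfl
  have hD : Uᵀ * N * U = diagonal hN.isHermitian.eigenvalues := by
    have : Uᵀ = star U := by rw [star_eq_conjTranspose, conjTranspose_eq_transpose_of_trivial]
    rw [this]
    conv_lhs => rw [hsp]
    calc star U * (U * diagonal hN.isHermitian.eigenvalues * star U) * U
        = (star U * U) * diagonal hN.isHermitian.eigenvalues * (star U * U) := by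
          simp only [Matrix.mul_assoc]
      _ = _ := by rw [hUU, Matrix.one_mul, Matrix.mul_one]
  have hq : ∀ y, (U *ᵥ y) ⬝ᵥ N *ᵥ (U *ᵥ y) = ∑ i, hN.isHermitian.eigenvalues i * y i ^ 2 := by
    intro y
    have : (U *ᵥ y) ⬝ᵥ N *ᵥ (U *ᵥ y) = y ⬝ᵥ (Uᵀ * N * U) *ᵥ y := by
      rw [← mulVec_mulVec, ← mulVec_mulVec, dotProduct_mulVec y, vecMul_transpose]
    rw [this, hD]
    simp only [dotProduct, mulVec_diagonal]
    exact Finset.sum_congr rfl fun i _ => by ring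
  rw [← piGaussian_map_mulVec hN.isHermitian, integral_map
    (by fun_prop) (by fun_prop)]
  simp_rw [← hU, hq]
  have hp : ∀ y : κ → ℝ, Real.exp (-((∑ i, hN.isHermitian.eigenvalues i * y i ^ 2) / 2))
      = ∏ i, Real.exp (-(hN.isHermitian.eigenvalues i * y i ^ 2 / 2)) := by
    intro y
    rw [← Real.exp_sum, Finset.sum_neg_distrib, Finset.sum_div]
  simp_rw [hp]
  rw [piGaussian, integral_fintype_prod_eq_prod
    (f := fun i x => Real.exp (-(hN.isHermitian.eigenvalues i * x ^ 2 / 2)))]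
  have hnn := hN.eigenvalues_nonneg
  have hdet := hN.isHermitian.det_smul_one_add_smul 1 1
  simp only [one_smul, one_mul] at hdet
  rw [hdet, ← Real.finsetProd_rpow _ _ (fun i _ => by linarith [hnn i])]
  exact Finset.prod_congr rfl fun i _ => integral_exp_neg_mul_sq_gaussianReal (hnn i)

/-- Half the squares of the coordinates of `A g`. -/
noncomputable def halfSq (A : Matrix ι κ ℝ) (g : κ → ℝ) : ι → ℝ≥0 :=
  fun i => Real.toNNReal ((A *ᵥ g) i ^ 2 / 2)

/-- The exponent is the quadratic form of `Aᵀ * L * A`, with `L` the diagonal matrix of `l`;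
Sylvester's determinant identity moves the determinant from `κ` to `ι`. -/
theorem integral_expNeg_halfSq [DecidableEq ι] (A : Matrix ι κ ℝ) (l : ι → ℝ≥0) :
    ∫ g, expNeg l (halfSq A g) ∂piGaussian κ
      = (1 + diagonal (fun i => (l i : ℝ)) * (A * Aᵀ)).det ^ (-(1 / 2) : ℝ) := by
  classical
  set L : Matrix ι ι ℝ := diagonal fun i => (l i : ℝ) with hL
  have hLp : L.PosSemidef := PosSemidef.diagonal fun i => (l i).2
  have hN : (Aᵀ * L * A).PosSemidef := by
    have := hLp.conjTranspose_mul_mul_same A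
    rwa [conjTranspose_eq_transpose_of_trivial] at this
  have hdet : (1 + L * (A * Aᵀ)).det = (1 + Aᵀ * L * A).det := by
    rw [← Matrix.mul_assoc, det_one_add_mul_comm, ← Matrix.mul_assoc]
  rw [hdet, ← integral_exp_neg_quadratic_piGaussian hN]
  refine integral_congr_ae (Filter.Eventually.of_forall fun g => ?_)
  have : g ⬝ᵥ (Aᵀ * L * A) *ᵥ g = ∑ i, (l i : ℝ) * (A *ᵥ g) i ^ 2 := by
    rw [← mulVec_mulVec, ← mulVec_mulVec, dotProduct_mulVec g, vecMul_transpose]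
    simp only [dotProduct, hL, mulVec_diagonal]
    exact Finset.sum_congr rfl fun i _ => by ring
  beta_reduce
  rw [this, expNeg, Finset.sum_div]
  congr 2
  refine Finset.sum_congr rfl fun i _ => ?_
  rw [halfSq, Real.coe_toNNReal _ (by positivity)]
  ring

/-- Three independent copies cube the transform. The exponent `-3/2` is the one produced by
differentiating a power `-1/2`. -/
theorem integral_expNeg_sum_halfSq [DecidableEq ι] {A : Matrix ι κ ℝ} (l : ι → ℝ≥0)
    (hdet : 0 ≤ (1 + diagonal (fun i => (l i : ℝ)) * (A * Aᵀ)).det) :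
    ∫ g : Fin 3 → κ → ℝ, expNeg l (∑ c, halfSq A (g c)) ∂Measure.pi (fun _ => piGaussian κ)
      = (1 + diagonal (fun i => (l i : ℝ)) * (A * Aᵀ)).det ^ (-(3 / 2) : ℝ) := by
  have h : ∀ g : Fin 3 → κ → ℝ, expNeg l (∑ c, halfSq A (g c))
      = ∏ c, expNeg l (halfSq A (g c)) := fun g => by
    simp only [Fin.sum_univ_three, Fin.prod_univ_three, expNeg_add_right]
  simp_rw [h]
  rw [integral_fintype_prod_eq_pow (fun g => expNeg l (halfSq A g)), integral_expNeg_halfSq,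
    ← Real.rpow_natCast, ← Real.rpow_mul hdet]
  norm_num

end GaussianSquares

/-! ### Interpolation between independent and correlated blocks. -/

section StripCorrelation

open Matrix
open scoped NNReal ENNReal

variable {ι κ : Type*}

/-- A factor of the matrix `crossScale (V * Vᵀ) b τ`. -/
noncomputable def crossFactor (V : Matrix ι κ ℝ) (b : ι → Bool) (τ : ℝ) : Matrix ι (κ ⊕ κ) ℝ :=
  Matrix.of fun i => Sum.elim (fun k => if b i then V i k else τ * V i k)
    (fun k => if b i then 0 else √(1 - τ ^ 2) * V i k)

section

variable [Fintype κ]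

/-- With two independent copies g, g', the `true` block is V g and the `false` block is V(τ g + √(1
- τ²) g'). Each block keeps its covariance, while the cross-covariance is scaled by `τ`. -/
theorem crossFactor_mul_transpose (V : Matrix ι κ ℝ) (b : ι → Bool) {τ : ℝ}
    (hτ : τ ∈ Set.Icc (0 : ℝ) 1) :
    crossFactor V b τ * (crossFactor V b τ)ᵀ = crossScale (V * Vᵀ) b τ := by
  have hs : √(1 - τ ^ 2) * √(1 - τ ^ 2) = 1 - τ ^ 2 :=
    Real.mul_self_sqrt (by nlinarith [hτ.1, hτ.2])
  ext i j
  simp only [crossFactor, crossScale, mul_apply, transpose_apply, of_apply, Fintype.sum_sum_type,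
    Sum.elim_inl, Sum.elim_inr]
  rw [← Finset.sum_add_distrib]
  cases hi : b i <;> cases hj : b j <;> simp only [Finset.mul_sum, if_true, if_false,
    reduceCtorEq, mul_zero, zero_mul, add_zero] <;> refine Finset.sum_congr rfl fun k _ => ?_
  · linear_combination (V i k * V j k) * hs
  all_goals ring

theorem measurable_halfSq_crossFactor {α : Type*} [MeasurableSpace α] (V : Matrix ι κ ℝ)
    (b : ι → Bool) {f : α → ℝ} {g : α → κ ⊕ κ → ℝ} (hf : Measurable f) (hg : Measurable g) :
    Measurable fun a => halfSq (crossFactor V b (f a)) (g a) := by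
  refine measurable_pi_lambda _ fun i => ?_
  simp only [halfSq, crossFactor, mulVec, dotProduct, of_apply, Fintype.sum_sum_type,
    Sum.elim_inl, Sum.elim_inr]
  cases b i <;> simp only [if_true, if_false, reduceCtorEq] <;> fun_prop

end

section

variable [DecidableEq ι]

/-- The principal minor of `crossScale C b τ` on the index set `s`. -/
noncomputable def crossMinor (C : Matrix ι ι ℝ) (b : ι → Bool) (s : Finset ι) (τ : ℝ) : ℝ :=
  ((crossScale C b τ).submatrix (Subtype.val : s → ι) Subtype.val).det

theorem contDiff_crossMinor (C : Matrix ι ι ℝ) (b : ι → Bool) (s : Finset ι) :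
    ContDiff ℝ 1 (crossMinor C b s) :=
  contDiff_det_crossScale (C.submatrix (Subtype.val : s → ι) Subtype.val) fun i => b i

theorem continuous_deriv_crossMinor (C : Matrix ι ι ℝ) (b : ι → Bool) (s : Finset ι) :
    Continuous (deriv (crossMinor C b s)) := (contDiff_crossMinor C b s).continuous_deriv le_rfl

/-- A principal submatrix of the scaled matrix is the scaling of a principal submatrix of `C`, so
the monotonicity of determinants applies to every minor. -/
theorem Matrix.PosSemidef.deriv_crossMinor_nonpos {C : Matrix ι ι ℝ} (hC : C.PosSemidef)
    (b : ι → Bool) (s : Finset ι) {τ : ℝ} (hτ : τ ∈ Set.Icc (0 : ℝ) 1) :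
    deriv (crossMinor C b s) τ ≤ 0 :=
  deriv_nonpos_of_antitoneOn_Icc (contDiff_crossMinor C b s)
    ((hC.submatrix _).antitoneOn_det_crossScale fun i : s => b i) hτ

end

variable [Fintype ι] [Fintype κ] [DecidableEq ι]

theorem Matrix.PosSemidef.one_le_det_one_add_diagonal_mul {C : Matrix ι ι ℝ} (hC : C.PosSemidef)
    (l : ι → ℝ≥0) : 1 ≤ (1 + diagonal (fun i => (l i : ℝ)) * C).det := by
  rw [det_one_add_diagonal_mul]
  have h := Finset.single_le_sum (f := fun s : Finset ι => (∏ i ∈ s, (l i : ℝ)) *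
    (C.submatrix (Subtype.val : s → ι) Subtype.val).det) (fun s _ => mul_nonneg
      (Finset.prod_nonneg fun i _ => (l i).2) (hC.submatrix _).det_nonneg) (Finset.mem_univ ∅)
  simpa using h

/-- The interpolation formula for `det (1 + ΛC(τ)) ^ (-1/2)`. -/
theorem Matrix.PosSemidef.rpow_det_sub_rpow_det {C : Matrix ι ι ℝ} (hC : C.PosSemidef)
    (b : ι → Bool) (l : ι → ℝ≥0) :
    (1 + diagonal (fun i => (l i : ℝ)) * _root_.crossScale C b 1).det ^ (-(1 / 2) : ℝ)
      - (1 + diagonal (fun i => (l i : ℝ)) * _root_.crossScale C b 0).det ^ (-(1 / 2) : ℝ)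
    = ∑ s : Finset ι, (∏ i ∈ s, (l i : ℝ)) * ∫ τ in Set.Ioc (0 : ℝ) 1,
        (-deriv (crossMinor C b s) τ / 2) *
          (1 + diagonal (fun i => (l i : ℝ)) * _root_.crossScale C b τ).det ^ (-(3 / 2) : ℝ) := by
  set D : ℝ → ℝ := fun τ => (1 + diagonal (fun i => (l i : ℝ)) * _root_.crossScale C b τ).det
    with hD
  have hDsum : D = fun τ => ∑ s : Finset ι, (∏ i ∈ s, (l i : ℝ)) * crossMinor C b s τ := by
    funext τ
    exact det_one_add_diagonal_mul _ _
  have hDpos : ∀ τ ∈ Set.Icc (0 : ℝ) 1, 0 < D τ := fun τ hτ =>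
    one_pos.trans_le ((hC.crossScale b hτ.1 hτ.2).one_le_det_one_add_diagonal_mul l)
  have hDd : ∀ τ, HasDerivAt D (∑ s : Finset ι, (∏ i ∈ s, (l i : ℝ)) *
      deriv (crossMinor C b s) τ) τ := fun τ => by
    rw [hDsum]
    refine HasDerivAt.fun_sum fun s _ => HasDerivAt.const_mul _ ?_
    exact ((contDiff_crossMinor C b s).differentiable one_ne_zero τ).hasDerivAt
  have hDc : Continuous D := continuous_iff_continuousAt.mpr fun τ => (hDd τ).continuousAt
  have hDr : ContinuousOn (fun τ => D τ ^ (-(3 / 2) : ℝ)) (Set.Icc 0 1) :=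
    hDc.continuousOn.rpow_const fun τ hτ => Or.inl (hDpos τ hτ).ne'
  have hterm : ∀ s : Finset ι, ContinuousOn (fun τ => (-deriv (crossMinor C b s) τ / 2) *
      D τ ^ (-(3 / 2) : ℝ)) (Set.Icc 0 1) := fun s =>
    (((continuous_deriv_crossMinor C b s).neg.div_const 2).continuousOn).mul hDr
  have hderiv : ∀ τ ∈ Set.uIcc (0 : ℝ) 1, HasDerivAt (fun τ => D τ ^ (-(1 / 2) : ℝ))
      (∑ s : Finset ι, (∏ i ∈ s, (l i : ℝ)) * ((-deriv (crossMinor C b s) τ / 2) *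
        D τ ^ (-(3 / 2) : ℝ))) τ := by
    intro τ hτ
    rw [Set.uIcc_of_le zero_le_one] at hτ
    convert (hDd τ).rpow_const (p := -(1 / 2)) (Or.inl (hDpos τ hτ).ne') using 1
    rw [Finset.sum_mul, Finset.sum_mul]
    refine Finset.sum_congr rfl fun s _ => ?_
    rw [show (-(1 / 2) - 1 : ℝ) = -(3 / 2) by norm_num]
    ring
  have hint : ∀ s : Finset ι, IntervalIntegrable (fun τ => (∏ i ∈ s, (l i : ℝ)) *
      ((-deriv (crossMinor C b s) τ / 2) * D τ ^ (-(3 / 2) : ℝ))) volume 0 1 := fun s => by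
    refine ContinuousOn.intervalIntegrable ?_
    rw [Set.uIcc_of_le zero_le_one]
    exact continuousOn_const.mul (hterm s)
  have key := intervalIntegral.integral_eq_sub_of_hasDerivAt hderiv
    (ContinuousOn.intervalIntegrable (by
      rw [Set.uIcc_of_le zero_le_one]
      exact continuousOn_finsetSum _ fun s _ => continuousOn_const.mul (hterm s)))
  rw [← key, intervalIntegral.integral_finsetSum fun s _ => hint s]
  refine Finset.sum_congr rfl fun s _ => ?_
  rw [intervalIntegral.integral_const_mul, intervalIntegral.integral_of_le zero_le_one]

/-- The representing measure is the mixture over `τ`, with density `w`, of the laws of sums of three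
independent half-square vectors with covariance `crossScale (V * Vᵀ) b τ`. -/
theorem isLaplaceTransform_integral_det (V : Matrix ι κ ℝ) (b : ι → Bool) {w : ℝ → ℝ}
    (hw : Continuous w) (hw0 : ∀ τ ∈ Set.Icc (0 : ℝ) 1, 0 ≤ w τ) :
    IsLaplaceTransform fun l : ι → ℝ≥0 => ∫ τ in Set.Ioc (0 : ℝ) 1, w τ *
      (1 + diagonal (fun i => (l i : ℝ)) * crossScale (V * Vᵀ) b τ).det ^ (-(3 / 2) : ℝ) := by
  set m : Measure ℝ := (volume.restrict (Set.Ioc (0 : ℝ) 1)).withDensity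
    fun τ => ENNReal.ofReal (w τ) with hm
  have hwi : IntegrableOn w (Set.Ioc (0 : ℝ) 1) volume :=
    (hw.continuousOn.integrableOn_Icc (μ := volume)).mono_set Set.Ioc_subset_Icc_self
  have hfin : IsFiniteMeasure m := isFiniteMeasure_withDensity_ofReal hwi.2
  have hW : Measurable fun p : ℝ × (Fin 3 → κ ⊕ κ → ℝ) =>
      ∑ c, halfSq (crossFactor V b p.1) (p.2 c) :=
    Finset.measurable_fun_sum _ fun c _ => measurable_halfSq_crossFactor V b
      measurable_fst ((measurable_pi_apply c).comp measurable_snd)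
  have h := IsLaplaceTransform.of_integral (m.prod (Measure.pi fun _ : Fin 3 =>
    piGaussian (κ ⊕ κ))) hW
  refine (congrArg IsLaplaceTransform (funext fun l => ?_)).mpr h
  rw [integral_prod _ (integrable_expNeg_comp _ hW l), hm,
    integral_withDensity_eq_integral_toReal_smul hw.measurable.ennreal_ofReal (by simp)]
  refine setIntegral_congr_fun measurableSet_Ioc fun τ hτ => ?_
  have hτ' : τ ∈ Set.Icc (0 : ℝ) 1 := Set.Ioc_subset_Icc_self hτ
  have hC : (V * Vᵀ).PosSemidef := by
    have := posSemidef_self_mul_conjTranspose V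
    rwa [conjTranspose_eq_transpose_of_trivial] at this
  have hd : 0 ≤ (1 + diagonal (fun i => (l i : ℝ)) *
      (crossFactor V b τ * (crossFactor V b τ)ᵀ)).det := by
    rw [crossFactor_mul_transpose V b hτ']
    exact zero_le_one.trans
      ((hC.crossScale b hτ'.1 hτ'.2).one_le_det_one_add_diagonal_mul l)
  simp only
  rw [integral_expNeg_sum_halfSq l hd, crossFactor_mul_transpose V b hτ',
    ENNReal.toReal_ofReal (hw0 τ hτ'), smul_eq_mul]

/-- Correlating two blocks of Gaussian variables increases the joint distribution function of their
squares. -/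
theorem measure_halfSq_crossFactor_zero_le_one (V : Matrix ι κ ℝ) (b : ι → Bool) (s : ι → ℝ≥0) :
    piGaussian (κ ⊕ κ) {g | halfSq (crossFactor V b 0) g ≤ s}
      ≤ piGaussian (κ ⊕ κ) {g | halfSq (crossFactor V b 1) g ≤ s} := by
  have hZ : ∀ τ : ℝ, Measurable (halfSq (crossFactor V b τ)) := fun τ =>
    measurable_halfSq_crossFactor V b measurable_const measurable_id
  have hC : (V * Vᵀ).PosSemidef := by
    have := posSemidef_self_mul_conjTranspose V
    rwa [conjTranspose_eq_transpose_of_trivial] at this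
  refine cdf_le_of_isLaplaceTransform _ _ (hZ 0) (hZ 1) ?_ s
  -- This is the interpolation formula at `1 + l` after cancellation: the monomial over `t` removes
  -- the factors with index in `t` from the full product of inverses, so only those over `tᶜ`
  -- remain.
  have h : IsLaplaceTransform fun l : ι → ℝ≥0 => ∑ t : Finset ι, (∏ i ∈ tᶜ, (1 + (l i : ℝ))⁻¹) *
      ∫ τ in Set.Ioc (0 : ℝ) 1, (-deriv (crossMinor (V * Vᵀ) b t) τ / 2) *
        (1 + diagonal (fun i => ((1 + l : ι → ℝ≥0) i : ℝ)) *
          crossScale (V * Vᵀ) b τ).det ^ (-(3 / 2) : ℝ) := by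
    refine IsLaplaceTransform.sum _ fun t _ => IsLaplaceTransform.mul
      (IsLaplaceTransform.prod _ fun i _ => IsLaplaceTransform.inv_one_add i) ?_
    have ht := isLaplaceTransform_integral_det V b
      (w := fun τ => -deriv (crossMinor (V * Vᵀ) b t) τ / 2)
      ((continuous_deriv_crossMinor (V * Vᵀ) b t).neg.div_const 2) fun τ hτ => by
        have := hC.deriv_crossMinor_nonpos b t hτ
        linarith
    exact ht.comp_add 1
  convert h using 2 with l
  rw [integral_expNeg_halfSq, integral_expNeg_halfSq,
    crossFactor_mul_transpose V b ⟨zero_le_one, le_rfl⟩,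
    crossFactor_mul_transpose V b ⟨le_rfl, zero_le_one⟩, hC.rpow_det_sub_rpow_det b (1 + l),
    Finset.mul_sum]
  refine Finset.sum_congr rfl fun t _ => ?_
  rw [← mul_assoc]
  congr 1
  rw [← Finset.prod_compl_mul_prod t, mul_assoc, ← Finset.prod_mul_distrib]
  conv_rhs => rw [← mul_one (∏ i ∈ tᶜ, (1 + (l i : ℝ))⁻¹)]
  congr 1
  refine Finset.prod_eq_one fun i _ => ?_
  have : (1 + (l i : ℝ)) ≠ 0 := by positivity
  simp [this]

theorem halfSq_le_iff {c : ℝ} (hc : 0 ≤ c) (x : ℝ) :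
    Real.toNNReal (x ^ 2 / 2) ≤ Real.toNNReal (c ^ 2 / 2) ↔ |x| ≤ c := by
  rw [Real.toNNReal_le_toNNReal_iff (by positivity), div_le_div_iff_of_pos_right two_pos,
    sq_le_sq, abs_of_nonneg hc]

/-- The Gaussian correlation inequality for finite intersections of symmetric strips. -/
theorem piGaussian_strips (V : Matrix ι κ ℝ) (b : ι → Bool) {c : ι → ℝ} (hc : ∀ i, 0 ≤ c i) :
    piGaussian κ {g | ∀ i, b i = true → |(V *ᵥ g) i| ≤ c i} *
        piGaussian κ {g | ∀ i, b i = false → |(V *ᵥ g) i| ≤ c i}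
      ≤ piGaussian κ {g | ∀ i, |(V *ᵥ g) i| ≤ c i} := by
  have h := measure_halfSq_crossFactor_zero_le_one V b fun i => Real.toNNReal (c i ^ 2 / 2)
  have hmp : MeasurePreserving (MeasurableEquiv.sumPiEquivProdPi fun _ : κ ⊕ κ => ℝ)
      (piGaussian (κ ⊕ κ)) ((piGaussian κ).prod (piGaussian κ)) :=
    measurePreserving_sumPiEquivProdPi (fun _ : κ ⊕ κ => gaussianReal 0 1)
  have hset : ∀ τ : ℝ, {g | halfSq (crossFactor V b τ) g ≤ fun i => Real.toNNReal (c i ^ 2 / 2)}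
      = {g | ∀ i, |(crossFactor V b τ *ᵥ g) i| ≤ c i} := fun τ => by
    ext g
    exact forall_congr' fun i => halfSq_le_iff (hc i) _
  have hmeas : ∀ p : ι → Prop, MeasurableSet {g : κ → ℝ | ∀ i, p i → |(V *ᵥ g) i| ≤ c i} := by
    intro p
    simp only [Set.ofPred_forall]
    exact MeasurableSet.iInter fun i => MeasurableSet.iInter fun _ =>
      measurableSet_le (by simp only [mulVec, dotProduct]; fun_prop) measurable_const
  have h1 : {g | ∀ i, |(crossFactor V b 1 *ᵥ g) i| ≤ c i}
      = (MeasurableEquiv.sumPiEquivProdPi fun _ : κ ⊕ κ => ℝ) ⁻¹'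
        ({g | ∀ i, |(V *ᵥ g) i| ≤ c i} ×ˢ Set.univ) := by
    ext g
    simp only [Set.mem_preimage, Set.mem_prod, Set.mem_univ, and_true, Set.mem_ofPred_eq]
    refine forall_congr' fun i => ?_
    have : (crossFactor V b 1 *ᵥ g) i = (V *ᵥ fun k => g (Sum.inl k)) i := by
      simp only [mulVec, dotProduct, crossFactor, of_apply, Fintype.sum_sum_type,
        Sum.elim_inl, Sum.elim_inr]
      simp
    rw [this]
    rfl
  -- At `τ = 0` the two blocks use different copies, so the event is a product set; at `τ = 1` only
  -- the first copy occurs.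
  have h0 : {g | ∀ i, |(crossFactor V b 0 *ᵥ g) i| ≤ c i}
      = (MeasurableEquiv.sumPiEquivProdPi fun _ : κ ⊕ κ => ℝ) ⁻¹'
        ({g | ∀ i, b i = true → |(V *ᵥ g) i| ≤ c i} ×ˢ
          {g | ∀ i, b i = false → |(V *ᵥ g) i| ≤ c i}) := by
    ext g
    simp only [Set.mem_preimage, Set.mem_prod, Set.mem_ofPred_eq, ← forall_and]
    refine forall_congr' fun i => ?_
    have ht : b i = true → (crossFactor V b 0 *ᵥ g) i = (V *ᵥ fun k => g (Sum.inl k)) i :=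
      fun hi => by
        simp only [mulVec, dotProduct, crossFactor, of_apply, Fintype.sum_sum_type,
          Sum.elim_inl, Sum.elim_inr, hi]
        simp
    have hf : b i = false → (crossFactor V b 0 *ᵥ g) i = (V *ᵥ fun k => g (Sum.inr k)) i :=
      fun hi => by
        simp only [mulVec, dotProduct, crossFactor, of_apply, Fintype.sum_sum_type,
          Sum.elim_inl, Sum.elim_inr, hi]
        simp
    cases hi : b i
    · rw [hf hi]
      simp only [reduceCtorEq, false_imp_iff, true_imp_iff, true_and]
      rfl
    · rw [ht hi]
      simp only [reduceCtorEq, false_imp_iff, true_imp_iff, and_true]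
      rfl
  have hmeas' : MeasurableSet {g : κ → ℝ | ∀ i, |(V *ᵥ g) i| ≤ c i} := by
    simpa using hmeas fun _ => True
  rw [hset, hset, h0, h1, hmp.measure_preimage ((hmeas _).prod (hmeas _)).nullMeasurableSet,
    hmp.measure_preimage (hmeas'.prod MeasurableSet.univ).nullMeasurableSet,
    Measure.prod_prod, Measure.prod_prod, measure_univ, mul_one] at h
  exact h

end StripCorrelation

/-! ### From finitely many strips to convex sets and arbitrary linear images. -/

section GaussianCorrelation

open Matrix
open scoped NNReal ENNReal

theorem MeasureTheory.Measure.AbsolutelyContinuous.pi_fin {μ ν : Measure ℝ} [SigmaFinite μ]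
    [SigmaFinite ν] (h : μ ≪ ν) (n : ℕ) :
    Measure.pi (fun _ : Fin n => μ) ≪ Measure.pi (fun _ : Fin n => ν) := by
  induction n with
  | zero => rw [Measure.pi_of_empty, Measure.pi_of_empty]
  | succ n ih =>
    have h1 := (measurePreserving_piFinSuccAbove (fun _ : Fin (n + 1) => μ) 0).symm
    have h2 := (measurePreserving_piFinSuccAbove (fun _ : Fin (n + 1) => ν) 0).symm
    rw [← h1.map_eq, ← h2.map_eq]
    exact (h.prod ih).map (MeasurableEquiv.measurable _)

theorem stdGaussian_absolutelyContinuous (n : ℕ) :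
    stdGaussian (EuclideanSpace ℝ (Fin n)) ≪ volume := by
  rw [← map_pi_eq_stdGaussian, ← (PiLp.volume_preserving_toLp (Fin n)).map_eq]
  exact ((gaussianReal_absolutelyContinuous 0 one_ne_zero).pi_fin n).map
    (WithLp.measurable_toLp 2 _)

/-- The Gaussian correlation inequality for finitely many strips given by linear functionals. -/
theorem stdGaussian_strips {n N : ℕ} (k m : Fin N → StrongDual ℝ (EuclideanSpace ℝ (Fin n)))
    {c d : Fin N → ℝ} (hc : ∀ i, 0 ≤ c i) (hd : ∀ i, 0 ≤ d i) :
    stdGaussian (EuclideanSpace ℝ (Fin n)) {x | ∀ i, |k i x| ≤ c i} *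
        stdGaussian (EuclideanSpace ℝ (Fin n)) {x | ∀ i, |m i x| ≤ d i}
      ≤ stdGaussian (EuclideanSpace ℝ (Fin n))
        ({x | ∀ i, |k i x| ≤ c i} ∩ {x | ∀ i, |m i x| ≤ d i}) := by
  have hmeas : ∀ (k : Fin N → StrongDual ℝ (EuclideanSpace ℝ (Fin n))) (c : Fin N → ℝ),
      MeasurableSet {x | ∀ i, |k i x| ≤ c i} := fun k c => by
    simp only [Set.ofPred_forall]
    exact MeasurableSet.iInter fun i =>
      measurableSet_le (by fun_prop) measurable_const
  have hfun : ∀ (f : StrongDual ℝ (EuclideanSpace ℝ (Fin n))) (g : Fin n → ℝ),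
      f (WithLp.toLp 2 g) = ∑ j, f (EuclideanSpace.single j 1) * g j := fun f g => by
    have : WithLp.toLp 2 g = ∑ j, g j • (EuclideanSpace.single j (1 : ℝ)) := by
      ext i
      simp [WithLp.ofLp_sum, Finset.sum_apply, Pi.single_apply]
    rw [this, map_sum]
    exact Finset.sum_congr rfl fun j _ => by rw [map_smul, smul_eq_mul, mul_comm]
  set V : Matrix (Fin N ⊕ Fin N) (Fin n) ℝ :=
    Matrix.of fun i j => (Sum.elim k m i) (EuclideanSpace.single j 1)
  have hV : ∀ g i, (V *ᵥ g) i = (Sum.elim k m i) (WithLp.toLp 2 g) := fun g i => by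
    rw [hfun]
    rfl
  have h := piGaussian_strips V Sum.isLeft (c := Sum.elim c d)
    (by rintro (i | i) <;> simp [hc, hd])
  rw [← map_pi_eq_stdGaussian, Measure.map_apply (WithLp.measurable_toLp 2 _) (hmeas k c),
    Measure.map_apply (WithLp.measurable_toLp 2 _) (hmeas m d),
    Measure.map_apply (WithLp.measurable_toLp 2 _) ((hmeas k c).inter (hmeas m d))]
  simp only [hV, Sum.forall, Sum.isLeft_inl, Sum.isLeft_inr, Sum.elim_inl, Sum.elim_inr,
    reduceCtorEq, true_imp_iff, false_imp_iff, implies_true, and_true, true_and] at h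
  exact h

/-- A nonempty closed convex symmetric set is a countable intersection of closed symmetric
strips. -/
theorem exists_strips_of_convex_symmetric {n : ℕ} {K : Set (EuclideanSpace ℝ (Fin n))}
    (hK : Convex ℝ K) (hsymm : ∀ x ∈ K, -x ∈ K) (hcl : IsClosed K) (hne : K.Nonempty) :
    ∃ (k : ℕ → StrongDual ℝ (EuclideanSpace ℝ (Fin n))) (c : ℕ → ℝ), (∀ i, 0 ≤ c i) ∧
      K = {x | ∀ i, |k i x| ≤ c i} := by
  obtain ⟨k, c, h⟩ := RCLike.iInter_countable_halfSpaces_eq (𝕜 := ℝ) hK hcl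
  have habs : ∀ x ∈ K, ∀ i, |k i x| ≤ c i := by
    have hle : ∀ x ∈ K, ∀ i, k i x ≤ c i := fun x hx i => by
      rw [← h] at hx
      simpa using Set.mem_iInter.mp hx i
    intro x hx i
    refine abs_le'.mpr ⟨hle x hx i, ?_⟩
    simpa using hle (-x) (hsymm x hx) i
  obtain ⟨x₀, hx₀⟩ := hne
  refine ⟨k, c, fun i => (abs_nonneg _).trans (habs x₀ hx₀ i), ?_⟩
  refine Set.Subset.antisymm habs fun x hx => ?_
  rw [← h]
  exact Set.mem_iInter.mpr fun i => by simpa using (le_abs_self _).trans (hx i)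

/-- The Gaussian correlation inequality for closed sets. -/
theorem stdGaussian_correlation_of_isClosed {n : ℕ} {K M : Set (EuclideanSpace ℝ (Fin n))}
    (hK : Convex ℝ K) (hKsymm : ∀ x ∈ K, -x ∈ K) (hKcl : IsClosed K)
    (hM : Convex ℝ M) (hMsymm : ∀ x ∈ M, -x ∈ M) (hMcl : IsClosed M) :
    stdGaussian (EuclideanSpace ℝ (Fin n)) K * stdGaussian (EuclideanSpace ℝ (Fin n)) M
      ≤ stdGaussian (EuclideanSpace ℝ (Fin n)) (K ∩ M) := by
  rcases K.eq_empty_or_nonempty with rfl | hKne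
  · simp
  rcases M.eq_empty_or_nonempty with rfl | hMne
  · simp
  obtain ⟨k, c, hc, rfl⟩ := exists_strips_of_convex_symmetric hK hKsymm hKcl hKne
  obtain ⟨m, d, hd, rfl⟩ := exists_strips_of_convex_symmetric hM hMsymm hMcl hMne
  set A : ℕ → Set (EuclideanSpace ℝ (Fin n)) := fun N =>
    {x | ∀ i : Fin N, |k i x| ≤ c i} ∩ {x | ∀ i : Fin N, |m i x| ≤ d i} with hA
  have hinter : {x | ∀ i, |k i x| ≤ c i} ∩ {x | ∀ i, |m i x| ≤ d i} = ⋂ N, A N := by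
    ext x
    simp only [hA, Set.mem_iInter, Set.mem_inter_iff, Set.mem_ofPred_eq]
    exact ⟨fun h N => ⟨fun i => h.1 i, fun i => h.2 i⟩, fun h =>
      ⟨fun i => (h (i + 1)).1 ⟨i, i.lt_succ_self⟩, fun i => (h (i + 1)).2 ⟨i, i.lt_succ_self⟩⟩⟩
  have hanti : Antitone A := fun N N' hN x hx =>
    ⟨fun i => hx.1 ⟨i, i.2.trans_le hN⟩, fun i => hx.2 ⟨i, i.2.trans_le hN⟩⟩
  have hmeas : ∀ N, MeasurableSet (A N) := fun N => by
    refine MeasurableSet.inter ?_ ?_ <;>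
    · simp only [Set.ofPred_forall]
      exact MeasurableSet.iInter fun i => measurableSet_le (by fun_prop) measurable_const
  rw [hinter, hanti.measure_iInter (fun N => (hmeas N).nullMeasurableSet) ⟨0, measure_ne_top _ _⟩]
  -- Truncating to `N` strips only enlarges the two factors on the left, so a limit is needed only
  -- for the intersection.
  refine le_iInf fun N => le_trans ?_ (stdGaussian_strips (fun i : Fin N => k i)
    (fun i : Fin N => m i) (fun i => hc i) (fun i => hd i))
  gcongr with x x
  · exact fun h i => h i
  · exact fun h i => h i

/-- The Gaussian correlation inequality, with closures on the smaller side. -/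
theorem stdGaussian_correlation {n : ℕ} {K M : Set (EuclideanSpace ℝ (Fin n))}
    (hK : Convex ℝ K) (hKsymm : ∀ x ∈ K, -x ∈ K) (hM : Convex ℝ M) (hMsymm : ∀ x ∈ M, -x ∈ M) :
    stdGaussian (EuclideanSpace ℝ (Fin n)) (closure K) *
        stdGaussian (EuclideanSpace ℝ (Fin n)) (closure M)
      ≤ stdGaussian (EuclideanSpace ℝ (Fin n)) (K ∩ M) := by
  have hcl : ∀ {S : Set (EuclideanSpace ℝ (Fin n))}, (∀ x ∈ S, -x ∈ S) →
      ∀ x ∈ closure S, -x ∈ closure S := fun {S} hS x hx => map_mem_closure continuous_neg hx hS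
  have hfr : ∀ {S : Set (EuclideanSpace ℝ (Fin n))}, Convex ℝ S →
      stdGaussian (EuclideanSpace ℝ (Fin n)) (frontier S) = 0 := fun hS =>
    stdGaussian_absolutelyContinuous n (hS.addHaar_frontier volume)
  refine (stdGaussian_correlation_of_isClosed hK.closure (hcl hKsymm) isClosed_closure
    hM.closure (hcl hMsymm) isClosed_closure).trans ?_
  have hsub : closure K ∩ closure M ⊆ (K ∩ M) ∪ (frontier K ∪ frontier M) := by
    rintro x ⟨hxK, hxM⟩
    rw [closure_eq_self_union_frontier] at hxK hxM
    rcases hxK with hxK | hxK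
    · rcases hxM with hxM | hxM
      · exact Or.inl ⟨hxK, hxM⟩
      · exact Or.inr (Or.inr hxM)
    · exact Or.inr (Or.inl hxK)
  calc _ ≤ stdGaussian (EuclideanSpace ℝ (Fin n)) ((K ∩ M) ∪ (frontier K ∪ frontier M)) :=
        measure_mono hsub
    _ ≤ stdGaussian (EuclideanSpace ℝ (Fin n)) (K ∩ M) +
        stdGaussian (EuclideanSpace ℝ (Fin n)) (frontier K ∪ frontier M) := measure_union_le _ _
    _ = _ := by rw [measure_union_null (hfr hK) (hfr hM), add_zero]

/-- The outer measure of a set under a linear image of a measure is bounded by the measure of the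
closure of its preimage. -/
theorem map_linearMap_le_measure_closure_preimage {E F : Type*} [NormedAddCommGroup E]
    [NormedSpace ℝ E] [FiniteDimensional ℝ E] [MeasurableSpace E] [BorelSpace E]
    [NormedAddCommGroup F] [NormedSpace ℝ F] [FiniteDimensional ℝ F] [MeasurableSpace F]
    [BorelSpace F] (γ : Measure E) (T : E →ₗ[ℝ] F) (K : Set F) :
    γ.map T K ≤ γ (closure (T ⁻¹' K)) := by
  have hT : Continuous T := T.continuous_of_finiteDimensional
  set R := LinearMap.range T
  have hRc : IsClosed (R : Set F) := R.closed_of_finiteDimensional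
  have hopen : IsOpenMap T.rangeRestrict :=
    T.rangeRestrict.isOpenMap_of_finiteDimensional T.surjective_rangeRestrict
  have hcont : Continuous T.rangeRestrict := T.rangeRestrict.continuous_of_finiteDimensional
  set K' : Set R := Subtype.val ⁻¹' K
  have himg : IsClosed (Subtype.val '' closure K' : Set F) :=
    hRc.isClosedEmbedding_subtypeVal.isClosedMap _ isClosed_closure
  -- A measurable superset of `K`. The closure is taken inside the range of `T`, onto which `T` is
  -- open, so that it commutes with preimages; the complement of the range has empty preimage.
  set S : Set F := (R : Set F)ᶜ ∪ Subtype.val '' closure K'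
  have hSm : MeasurableSet S := hRc.measurableSet.compl.union himg.measurableSet
  have hKS : K ⊆ S := fun y hy => by
    by_cases hyR : y ∈ R
    · exact Or.inr ⟨⟨y, hyR⟩, subset_closure hy, rfl⟩
    · exact Or.inl hyR
  have hpre : T ⁻¹' S ⊆ closure (T ⁻¹' K) := by
    have h2 : T ⁻¹' K = T.rangeRestrict ⁻¹' K' := rfl
    rw [h2, ← hopen.preimage_closure_eq_closure_preimage hcont]
    rintro x (hx | ⟨y, hy, hyx⟩)
    · exact absurd (LinearMap.mem_range_self T x) hx
    · have : T.rangeRestrict x = y := Subtype.ext hyx.symm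
      rwa [Set.mem_preimage, this]
  calc γ.map T K ≤ γ.map T S := measure_mono hKS
    _ = γ (T ⁻¹' S) := Measure.map_apply hT.measurable hSm
    _ ≤ _ := measure_mono hpre

end GaussianCorrelation

theorem theorem1 (n : ℕ) (hn : 4 ≤ n) (hstrip : StripCorrelation n)
    (μ : Measure (EuclideanSpace ℝ (Fin n))) (hμ : IsMeanZeroGaussian μ)
    (K M : Set (EuclideanSpace ℝ (Fin n)))
    (hK : Convex ℝ K) (hKsymm : ∀ x ∈ K, -x ∈ K)
    (hM : Convex ℝ M) (hMsymm : ∀ x ∈ M, -x ∈ M) :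
    μ (K ∩ M) ≥ μ K * μ M := by
  obtain ⟨T, rfl⟩ := hμ
  have hT : Continuous T := T.continuous_of_finiteDimensional
  have hpre : ∀ {S : Set (EuclideanSpace ℝ (Fin n))}, (∀ x ∈ S, -x ∈ S) →
      ∀ x ∈ T ⁻¹' S, -x ∈ T ⁻¹' S := fun hS x hx => by
    rw [Set.mem_preimage, map_neg]
    exact hS _ hx
  -- For singular `T` the image measure may charge the frontiers of `K` and `M`, and these sets need
  -- not be Borel. The comparison is therefore made between the convex preimages, whose frontiers
  -- are null for the standard Gaussian.
  calc _ ≤ stdGaussian (EuclideanSpace ℝ (Fin n)) (closure (T ⁻¹' K)) *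
        stdGaussian (EuclideanSpace ℝ (Fin n)) (closure (T ⁻¹' M)) :=
        mul_le_mul' (map_linearMap_le_measure_closure_preimage _ T K)
          (map_linearMap_le_measure_closure_preimage _ T M)
    _ ≤ stdGaussian (EuclideanSpace ℝ (Fin n)) (T ⁻¹' K ∩ T ⁻¹' M) :=
      stdGaussian_correlation (hK.linear_preimage T) (hpre hKsymm) (hM.linear_preimage T)
        (hpre hMsymm)
    _ ≤ _ := Measure.le_map_apply hT.aemeasurable (K ∩ M)
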